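/- Let $G$ be a finite simple graph. A set $C\subseteq V(G)$ is monophonically convex if it contains every vertex of every induced path joining two vertices of $C$; the hull $\langle S\rangle$ is the smallest monophonically convex set containing $S$; $S$ is monophonically convexly independent if $v\notin\langle S\setminus\{v\}\rangle$ for every $v\in S$; and the monophonic rank $r(G)$ is the maximum size of a monophonically convexly independent set of $G$. A connected graph is prime if it has no clique separator, and an mp-subgraph of a graph $H$ is a maximal induced subgraph of $H$ that is prime. For an mp-subgraph $M$ of $H$, let $\partial M$ be the set of vertices of $M$ that belong to other mp-subgraphs of $H$, and let $M^\circ=V(M)\setminus\partial M$. Call $M$ a petal of $H$ if $M^\circ\neq\varnothing$ and $\partial M$ is a (possibly empty) clique, and let $\mathcal P(H)$ be the set of petals of $H$. The flower subgraphs of $G$ are $G$ itself and, recursively, every graph $G'-M^\circ$ where $G'$ is a flower subgraph of $G$ and $M$ is a petal of $G'$; let $\mathcal F(G)$ be the set of flower subgraphs of $G$. For a petal $M$ of $H$, a set $X\subseteq M^\circ$ is a stamen set of $M$ in $H$ if (1) $|X|=1$, or (2) $X=\{u_1,u_2\}$ and every vertex of $\partial M$ is adjacent to both $u_1$ and $u_2$,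 or (3) $|X|\ge 2$ and $X\cup\partial M$ is a clique. Let $s_H(M)$ be the maximum size of a stamen set of $M$ in $H$. Then $$r(G)=\max_{G'\in\mathcal F(G)}\ \sum_{M\in\mathcal P(G')} s_{G'}(M).$$ -/

import Mathlib

namespace Monophonic

variable {V : Type*}

/-- The walk `p` is an induced path: a path without chords. -/
def IsInducedPath (G : SimpleGraph V) {u v : V} (p : G.Walk u v) : Prop :=
  p.IsPath ∧ p.IsChordless

/-- Monophonically convex sets. -/
def IsMConvex (G : SimpleGraph V) (S : Set V) : Prop :=
  ∀ ⦃u v : V⦄, u ∈ S → v ∈ S → ∀ p : G.Walk u v, IsInducedPath G p → ∀ x ∈ p.support, x ∈ S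

/-- The monophonic convex hull of `S`, the smallest monophonically convex set containing `S`. -/
def mHull (G : SimpleGraph V) (S : Set V) : Set V :=
  ⋂₀ {C : Set V | S ⊆ C ∧ IsMConvex G C}

theorem subset_mHull (G : SimpleGraph V) (S : Set V) : S ⊆ mHull G S :=
  Set.subset_sInter fun _ hC => hC.1

theorem isMConvex_mHull (G : SimpleGraph V) (S : Set V) : IsMConvex G (mHull G S) :=
  fun _ _ hu hv p hp x hx C hC => hC.2 (hu C hC) (hv C hC) p hp x hx

/-- Monophonic convexly independent sets. -/
def IsMConvexlyIndep (G : SimpleGraph V) (S : Set V) : Prop :=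
  ∀ v ∈ S, v ∉ mHull G (S \ {v})

/-- The monophonic rank of a finite graph: the maximum size of a monophonic convexly
independent set. -/
noncomputable def mRank (G : SimpleGraph V) : ℕ :=
  sSup {n : ℕ | ∃ S : Set V, IsMConvexlyIndep G S ∧ S.ncard = n}

theorem mRank_isGreatest [Finite V] (G : SimpleGraph V) :
    IsGreatest {n : ℕ | ∃ S : Set V, IsMConvexlyIndep G S ∧ S.ncard = n} (mRank G) := by
  have hb : BddAbove {n : ℕ | ∃ S : Set V, IsMConvexlyIndep G S ∧ S.ncard = n} := by
    refine ⟨(Set.univ : Set V).ncard, ?_⟩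
    rintro n ⟨S, -, rfl⟩
    exact Set.ncard_le_ncard (Set.subset_univ S) (Set.toFinite _)
  have hne : {n : ℕ | ∃ S : Set V, IsMConvexlyIndep G S ∧ S.ncard = n}.Nonempty :=
    ⟨0, ∅, fun v hv => absurd hv (Set.notMem_empty v), Set.ncard_empty V⟩
  exact ⟨Nat.sSup_mem hne hb, fun n hn => le_csSup hb hn⟩

/-! Induced subgraphs of `G` are given by their vertex sets: below, a set `A` of vertices stands for
the subgraph `G[A]` of `G` induced by `A`, and `Set.univ` stands for `G` itself. -/

/-- `C` is a clique separator of `G[A]`: a clique of `G[A]` such that `G[A] - C` is disconnected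
(has two vertices that no path joins). -/
def IsCliqueSeparator (G : SimpleGraph V) (A C : Set V) : Prop :=
  C ⊆ A ∧ G.IsClique C ∧ ¬ (G.induce (A \ C)).Preconnected

/-- `G[A]` is prime: it is connected and has no clique separator. -/
def IsPrimeSubgraph (G : SimpleGraph V) (A : Set V) : Prop :=
  (G.induce A).Connected ∧ ∀ C : Set V, ¬ IsCliqueSeparator G A C

/-- `G[M]` is a maximal prime subgraph (mp-subgraph) of `G[A]`. -/
def IsMPSubgraph (G : SimpleGraph V) (A M : Set V) : Prop :=
  Maximal (fun X : Set V => X ⊆ A ∧ IsPrimeSubgraph G X) M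

/-- The border of `M` in `G[A]`: the vertices of `M` that belong to other mp-subgraphs of `G[A]`. -/
def border (G : SimpleGraph V) (A M : Set V) : Set V :=
  {v | v ∈ M ∧ ∃ M' : Set V, IsMPSubgraph G A M' ∧ M' ≠ M ∧ v ∈ M'}

/-- The vertices of `M` that belong to no other mp-subgraph of `G[A]`. -/
def core (G : SimpleGraph V) (A M : Set V) : Set V :=
  M \ border G A M

/-- `M` is a petal mp-subgraph of `G[A]`. -/
def IsPetal (G : SimpleGraph V) (A M : Set V) : Prop :=
  IsMPSubgraph G A M ∧ (core G A M).Nonempty ∧ G.IsClique (border G A M)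

/-- The flower subgraphs of `G`: `G` itself, and whatever is obtained from a flower subgraph `G[A]`
by removing the non-border vertices of one of its petal mp-subgraphs. -/
inductive IsFlower (G : SimpleGraph V) : Set V → Prop
  | self : IsFlower G Set.univ
  | remove {A M : Set V} : IsFlower G A → IsPetal G A M → IsFlower G (A \ core G A M)

/-- `X` is a stamen set for `M` in `G[A]` (of Type 1, 2 or 3). -/
def IsStamenSet (G : SimpleGraph V) (A M X : Set V) : Prop :=
  X ⊆ core G A M ∧
    (X.ncard = 1 ∨
      (∃ u₁ u₂ : V, X = {u₁, u₂} ∧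
        border G A M ⊆ G.neighborSet u₁ ∧ border G A M ⊆ G.neighborSet u₂) ∨
      (G.IsClique (X ∪ border G A M) ∧ 2 ≤ X.ncard))

/-- The maximum size of a stamen set for `M` in `G[A]`. -/
noncomputable def stamenNumber (G : SimpleGraph V) (A M : Set V) : ℕ :=
  sSup {n : ℕ | ∃ X : Set V, IsStamenSet G A M X ∧ X.ncard = n}

theorem stamenNumber_isGreatest [Finite V] (G : SimpleGraph V) {A M : Set V}
    (hM : IsPetal G A M) :
    IsGreatest {n : ℕ | ∃ X : Set V, IsStamenSet G A M X ∧ X.ncard = n} (stamenNumber G A M) := by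
  have hb : BddAbove {n : ℕ | ∃ X : Set V, IsStamenSet G A M X ∧ X.ncard = n} := by
    refine ⟨(Set.univ : Set V).ncard, ?_⟩
    rintro n ⟨X, -, rfl⟩
    exact Set.ncard_le_ncard (Set.subset_univ X) (Set.toFinite _)
  have hne : {n : ℕ | ∃ X : Set V, IsStamenSet G A M X ∧ X.ncard = n}.Nonempty := by
    obtain ⟨v, hv⟩ := hM.2.1
    exact ⟨1, {v}, ⟨Set.singleton_subset_iff.2 hv, Or.inl (Set.ncard_singleton v)⟩,
      Set.ncard_singleton v⟩
  exact ⟨Nat.sSup_mem hne hb, fun n hn => le_csSup hb hn⟩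

/-- The finite family of the petal mp-subgraphs of `G[A]`. -/
noncomputable def petals [Finite V] (G : SimpleGraph V) (A : Set V) : Finset (Set V) :=
  (Set.toFinite {M : Set V | IsPetal G A M}).toFinset

end Monophonic

/-! Lower bound. Let `M` be a petal of `G[A]`. The core of `M` is attached to the rest of `G[A]` only
through the clique `border G A M`, so `(A \ core G A M) ∪ W` is convex whenever `A` is convex,
`W ⊆ core G A M` and `W ∪ border G A M` is a clique: an induced path leaving this set would leave
and reenter it through two vertices of a clique (`isMConvex_diff_core_union`). With `W = ∅` this
shows that flower subgraphs are convex. With `W = X \ {v}`, where `X` is a stamen set, it yields a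
convex set separating `v` from the rest of a union of stamen sets, one in each petal. Hence such
unions are independent.

Upper bound. The basic objects are the ends of `G[A]`: nonempty sets `K ⊆ A` whose outer
neighbourhood in `G[A]` is a clique. They arise from convex sets, because a component of `A \ C` with
`C` convex is an end (`exists_isEnd_of_notMem`). A prime subgraph that meets an end stays in its
closed neighbourhood (`subset_of_isPrimeSubgraph`), and the closed neighbourhood of a minimal end is a
petal whose core contains that end (`IsEnd.exists_isPetal`).

Let `S` be independent and let `A ⊇ S` be a minimal flower subgraph, so that the core of each petal
meets `S`. A component of the complement of the hull of `S \ {v}`, with `v ∈ S`, is an end `K`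
meeting `S` at most in `v`. If `v` were in no petal core, or if a second vertex of `S` in the core
of a petal `M` were not joined to all of the border of `M`, then a petal whose core misses `S` would
fit inside `K` (`exists_isPetal_core_subset_diff`). So `S` is covered by the petal cores, and it
meets each of them in a stamen set, since in a prime subgraph the hull of any two nonadjacent
vertices contains all of that subgraph. -/

namespace Monophonic

variable {V : Type*} {G : SimpleGraph V} {A C K M S X : Set V} {u v x : V}

/-! ### Induced paths -/

/-- A walk of minimal length among those staying within a given vertex set is an induced path. -/
theorem exists_isInducedPath (p : G.Walk u v) :
    ∃ q : G.Walk u v, IsInducedPath G q ∧ q.support ⊆ p.support := by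
  classical
  have hex : ∃ n, ∃ q : G.Walk u v, q.support ⊆ p.support ∧ q.length = n :=
    ⟨_, p, List.Subset.refl _, rfl⟩
  obtain ⟨q₀, hq₀, hl₀⟩ := Nat.find_spec hex
  have hmin : ∀ r : G.Walk u v, r.support ⊆ p.support → q₀.length ≤ r.length := fun r hr => by
    rw [hl₀]
    exact Nat.find_min' hex ⟨r, hr, rfl⟩
  have hsub : q₀.bypass.support ⊆ p.support :=
    List.Subset.trans q₀.support_bypass_subset_support hq₀
  have hlen : q₀.bypass.length ≤ q₀.length := q₀.length_bypass_le_length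
  refine ⟨q₀.bypass, ⟨q₀.bypass_isPath, ?_⟩, hsub⟩
  generalize q₀.bypass = q at hsub hlen
  -- A chord would give a shortcut.
  have key : ∀ i j, i < j → j ≤ q.length → G.Adj (q.getVert i) (q.getVert j) → j = i + 1 := by
    intro i j hij hj hadj
    have h := hmin ((q.take i).append (SimpleGraph.Walk.cons hadj (q.drop j))) ?_
    · simp only [SimpleGraph.Walk.length_append, SimpleGraph.Walk.take_length,
        SimpleGraph.Walk.length_cons, SimpleGraph.Walk.drop_length] at h
      omega
    · intro z hz
      rw [SimpleGraph.Walk.mem_support_append_iff, SimpleGraph.Walk.support_cons,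
        List.mem_cons] at hz
      rcases hz with hz | rfl | hz
      · exact hsub ((q.isSubwalk_take i).support_subset hz)
      · exact hsub (q.getVert_mem_support i)
      · exact hsub ((q.isSubwalk_drop j).support_subset hz)
  rw [SimpleGraph.Walk.isChordless_iff_forall_mem_edges]
  intro a b ha hb hab
  obtain ⟨i, rfl, hi⟩ := SimpleGraph.Walk.mem_support_iff_exists_getVert.1 ha
  obtain ⟨j, rfl, hj⟩ := SimpleGraph.Walk.mem_support_iff_exists_getVert.1 hb
  rw [← SimpleGraph.Walk.adj_toSubgraph_iff_mem_edges]
  rcases lt_trichotomy i j with h | rfl | h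
  · obtain rfl := key i j h hj hab
    exact q.toSubgraph_adj_getVert (by omega)
  · exact absurd hab (G.loopless.irrefl _)
  · obtain rfl := key j i h hi hab.symm
    exact (q.toSubgraph_adj_getVert (by omega)).symm

/-- The ends of a walk all of whose other vertices avoid a convex set containing both ends are equal
or adjacent. -/
theorem IsMConvex.eq_or_adj (hC : IsMConvex G C) (hu : u ∈ C) (hv : v ∈ C) (p : G.Walk u v)
    (hp : ∀ z ∈ p.support, z = u ∨ z = v ∨ z ∉ C) : u = v ∨ G.Adj u v := by
  obtain ⟨q, hq, hqp⟩ := exists_isInducedPath p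
  have hsub : ∀ z ∈ q.support, z = u ∨ z = v := fun z hz => by
    have := hp z (hqp hz)
    have := hC hu hv q hq z hz
    tauto
  cases q with
  | nil => exact Or.inl rfl
  | cons h q' =>
    rcases hsub _ (List.mem_cons_of_mem _ q'.start_mem_support) with rfl | rfl
    · exact absurd h (G.loopless.irrefl _)
    · exact Or.inr h

/-- Two vertices of an induced path that have a vertex outside `X` between them are not both in
`X`, if `X` is a clique. -/
theorem IsInducedPath.false_of_isClique {p : G.Walk u v} (hp : IsInducedPath G p)
    (hX : G.IsClique X) {i j k : ℕ} (hij : i < j) (hjk : j < k) (hk : k ≤ p.length)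
    (hiX : p.getVert i ∈ X) (hkX : p.getVert k ∈ X) : False := by
  have hinj := hp.1.getVert_injOn
  have hne : p.getVert i ≠ p.getVert k := fun h => by
    have := hinj (by simp; omega) (by simp; omega) h
    omega
  have he := hp.2.mem_edges (p.getVert_mem_support i) (p.getVert_mem_support k) (hX hiX hkX hne)
  rw [← SimpleGraph.Walk.adj_toSubgraph_iff_mem_edges, SimpleGraph.Walk.toSubgraph_adj_iff] at he
  obtain ⟨n, hn, hnl⟩ := he
  rcases Sym2.eq_iff.1 hn with ⟨h1, h2⟩ | ⟨h1, h2⟩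
  · have := hinj (by simp; omega) (by simp; omega) h1
    have := hinj (by simp; omega) (by simp; omega) h2
    omega
  · have := hinj (by simp; omega) (by simp; omega) h1
    have := hinj (by simp; omega) (by simp; omega) h2
    omega

/-! ### Outer neighbourhoods, prime subgraphs and ends -/

/-- The outer neighbourhood of `K` in `G[A]`. -/
def outerNbr (G : SimpleGraph V) (A K : Set V) : Set V :=
  {y | y ∈ A ∧ y ∉ K ∧ ∃ k ∈ K, G.Adj k y}

/-- `K` is an end of `G[A]`: a nonempty set of vertices of `G[A]` (not necessarily connected) that
is attached to the rest of `G[A]` through a clique. -/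
def IsEnd (G : SimpleGraph V) (A K : Set V) : Prop :=
  K ⊆ A ∧ K.Nonempty ∧ G.IsClique (outerNbr G A K)

theorem induce_preconnected_iff :
    (G.induce X).Preconnected ↔
      ∀ D ⊆ X, D.Nonempty → (∀ d ∈ D, ∀ y ∈ X, G.Adj d y → y ∈ D) → X ⊆ D := by
  constructor
  · rintro h D hD ⟨d, hd⟩ hcl y hy
    have hr := (SimpleGraph.reachable_iff_reflTransGen _ _).1 (h ⟨d, hD hd⟩ ⟨y, hy⟩)
    have : ∀ z : X, Relation.ReflTransGen (G.induce X).Adj ⟨d, hD hd⟩ z → (z : V) ∈ D := by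
      intro z hz
      induction hz with
      | refl => exact hd
      | tail _ hab ih => exact hcl _ ih _ (Subtype.coe_prop _) hab
    exact this _ hr
  · intro h a b
    have := h {z | ∃ hz : z ∈ X, (G.induce X).Reachable a ⟨z, hz⟩} (fun z hz => hz.1)
      ⟨a, a.2, SimpleGraph.Reachable.refl _⟩ (fun d ⟨hd, hr⟩ y hy hdy =>
        ⟨hy, hr.trans (SimpleGraph.Adj.reachable (by exact hdy))⟩) b.2
    exact this.2

theorem isPrimeSubgraph_of_isClique (hX : G.IsClique X) (hne : X.Nonempty) :
    IsPrimeSubgraph G X := by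
  have hpre : ∀ Y ⊆ X, (G.induce Y).Preconnected := fun Y hY =>
    induce_preconnected_iff.2 fun D hD ⟨d, hd⟩ hcl y hy => by
      by_cases hdy : d = y
      · exact hdy ▸ hd
      · exact hcl d hd y hy (hX (hY (hD hd)) (hY hy) hdy)
  have := hne.to_subtype
  exact ⟨⟨hpre X subset_rfl⟩, fun C hC => hC.2.2 (hpre _ Set.sdiff_subset)⟩

theorem exists_isMPSubgraph [Finite V] (hX : IsPrimeSubgraph G X) (hXA : X ⊆ A) :
    ∃ M, X ⊆ M ∧ IsMPSubgraph G A M :=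
  Finite.exists_le_maximal (p := fun X : Set V => X ⊆ A ∧ IsPrimeSubgraph G X) ⟨hXA, hX⟩

theorem IsMPSubgraph.eq_of_subset {M' : Set V} (hM : IsMPSubgraph G A M)
    (hM' : IsMPSubgraph G A M') (h : M ⊆ M') : M = M' :=
  hM.eq_of_le hM'.prop h

/-- The clique through which an end is attached does not separate a prime subgraph. -/
theorem subset_of_isPrimeSubgraph (hK : G.IsClique (outerNbr G A K)) (hX : IsPrimeSubgraph G X)
    (hXA : X ⊆ A) (hx : x ∈ X) (hxK : x ∈ K) : X ⊆ K ∪ outerNbr G A K := by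
  have hpre : (G.induce (X \ (outerNbr G A K ∩ X))).Preconnected := by
    by_contra h
    exact hX.2 _ ⟨Set.inter_subset_right, hK.subset Set.inter_subset_left, h⟩
  have := induce_preconnected_iff.1 hpre (X ∩ K) ?_ ⟨x, hx, hxK⟩ ?_
  · intro y hy
    by_cases hyN : y ∈ outerNbr G A K
    · exact Or.inr hyN
    · exact Or.inl (this ⟨hy, fun h => hyN h.1⟩).2
  · exact fun y hy => ⟨hy.1, fun h => h.1.2.1 hy.2⟩
  · intro d hd y hy hdy
    refine ⟨hy.1, ?_⟩
    by_contra hyK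
    exact hy.2 ⟨⟨hXA hy.1, hyK, d, hd.2, hdy⟩, hy.1⟩

/-- The closed neighbourhood of a minimal end is prime. -/
theorem isPrimeSubgraph_of_minimal (hK : Minimal (IsEnd G A) K) :
    IsPrimeSubgraph G (K ∪ outerNbr G A K) := by
  obtain ⟨hKA, hKne, hKcl⟩ := hK.prop
  have hpre : ∀ C, G.IsClique C → (G.induce ((K ∪ outerNbr G A K) \ C)).Preconnected := by
    intro C hC
    rw [induce_preconnected_iff]
    -- A nonempty union of components that misses the outer neighbourhood is an end inside `K`.
    have aux : ∀ E ⊆ (K ∪ outerNbr G A K) \ C, E.Nonempty →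
        (∀ d ∈ E, ∀ y ∈ (K ∪ outerNbr G A K) \ C, G.Adj d y → y ∈ E) →
        Disjoint E (outerNbr G A K) → (K ∪ outerNbr G A K) \ C ⊆ E := by
      intro E hE hEne hEcl hdis
      have hEK : E ⊆ K := fun z hz =>
        (hE hz).1.resolve_right fun h => Set.disjoint_left.1 hdis hz h
      have hend : IsEnd G A E := by
        refine ⟨hEK.trans hKA, hEne, hC.subset ?_⟩
        rintro y ⟨hyA, hyE, k, hk, hky⟩
        by_contra hyC
        refine hyE (hEcl k hk y ⟨?_, hyC⟩ hky)
        by_cases hyK : y ∈ K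
        · exact Or.inl hyK
        · exact Or.inr ⟨hyA, hyK, k, hEK hk, hky⟩
      have hKE : K ⊆ E := hK.le_of_le hend hEK
      rintro y ⟨hy | hy, hyC⟩
      · exact hKE hy
      · obtain ⟨k, hk, hky⟩ := hy.2.2
        exact hEcl k (hKE hk) y ⟨Or.inr hy, hyC⟩ hky
    intro D hD hDne hDcl
    by_cases hdis : Disjoint D (outerNbr G A K)
    · exact aux D hD hDne hDcl hdis
    obtain ⟨q, hqD, hq⟩ := Set.not_disjoint_iff.1 hdis
    -- The outer neighbourhood is a clique, so it cannot also meet the complement of `D`.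
    by_contra hnot
    obtain ⟨t, ht, htD⟩ := Set.not_subset.1 hnot
    refine (aux (((K ∪ outerNbr G A K) \ C) \ D) Set.sdiff_subset ⟨t, ht, htD⟩ ?_ ?_ (hD hqD)).2 hqD
    · exact fun d hd y hy hdy => ⟨hy, fun hyD => hd.2 (hDcl y hyD d hd.1 hdy.symm)⟩
    · refine Set.disjoint_left.2 fun z hz hzN => hz.2 (hDcl q hqD z hz.1 (hKcl hq hzN ?_))
      rintro rfl
      exact hz.2 hqD
  obtain ⟨k, hk⟩ := hKne
  have : Nonempty ↑(K ∪ outerNbr G A K) := ⟨⟨k, Or.inl hk⟩⟩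
  refine ⟨⟨?_⟩, fun C hC => hC.2.2 (hpre C hC.2.1)⟩
  have := hpre ∅ SimpleGraph.isClique_empty
  rwa [Set.sdiff_empty] at this

/-- Each end contains an end whose closed neighbourhood is a petal. -/
theorem IsEnd.exists_isPetal [Finite V] (hK : IsEnd G A K) :
    ∃ L ⊆ K, L.Nonempty ∧ IsPetal G A (L ∪ outerNbr G A L) ∧
      L ⊆ core G A (L ∪ outerNbr G A L) := by
  obtain ⟨L, hLK, hL⟩ :=
    (Set.toFinite {L | IsEnd G A L}).exists_le_minimal (a := K) hK
  replace hL : Minimal (IsEnd G A) L := hL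
  obtain ⟨hLA, hLne, hLcl⟩ := hL.prop
  have hprime := isPrimeSubgraph_of_minimal hL
  have hsub : L ∪ outerNbr G A L ⊆ A := Set.union_subset hLA fun y hy => hy.1
  have hmp : IsMPSubgraph G A (L ∪ outerNbr G A L) := by
    refine ⟨⟨hsub, hprime⟩, fun X hX hle => ?_⟩
    obtain ⟨l, hl⟩ := hLne
    exact subset_of_isPrimeSubgraph hLcl hX.2 hX.1 (hle (Or.inl hl)) hl
  have hborder : ∀ l ∈ L, l ∉ border G A (L ∪ outerNbr G A L) := by
    rintro l hl ⟨-, M', hM', hne, hlM'⟩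
    exact hne (hM'.eq_of_subset hmp
      (subset_of_isPrimeSubgraph hLcl hM'.prop.2 hM'.prop.1 hlM' hl))
  have hcore : L ⊆ core G A (L ∪ outerNbr G A L) := fun l hl => ⟨Or.inl hl, hborder l hl⟩
  exact ⟨L, hLK, hLne, ⟨hmp, hLne.mono hcore,
    hLcl.subset fun y hy => hy.1.resolve_left fun h => hborder y h hy⟩, hcore⟩

/-! ### Cores and borders -/

theorem core_subset (hM : IsMPSubgraph G A M) : core G A M ⊆ A :=
  Set.sdiff_subset.trans hM.prop.1

theorem mem_of_adj_core [Finite V] (hM : IsMPSubgraph G A M) (hu : u ∈ core G A M) (hv : v ∈ A)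
    (huv : G.Adj u v) : v ∈ M := by
  have hcl : G.IsClique {u, v} := SimpleGraph.isClique_pair.2 fun _ => huv
  obtain ⟨M', hsub, hM'⟩ := exists_isMPSubgraph (A := A)
    (isPrimeSubgraph_of_isClique hcl ⟨u, Or.inl rfl⟩)
    (Set.pair_subset (core_subset hM hu) hv)
  by_contra hvM
  refine hu.2 ⟨hu.1, M', hM', ?_, hsub (Or.inl rfl)⟩
  rintro rfl
  exact hvM (hsub (Or.inr rfl))

theorem notMem_core_of_ne {M' : Set V} (hM' : IsMPSubgraph G A M') (hne : M' ≠ M)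
    (hx : x ∈ M') : x ∉ core G A M :=
  fun h => h.2 ⟨h.1, M', hM', hne, hx⟩

/-- If the core of a petal `M` meets the clique through which an end `K` is attached, then what
remains of `K` outside `M` is attached through the border of `M`; so if `K` does not lie within the
core of `M`, then `K \ M` contains the core of another petal. -/
theorem exists_isPetal_core_subset_diff [Finite V] (hM : IsPetal G A M) (hK : IsEnd G A K)
    (hu : u ∈ core G A M) (huK : u ∈ outerNbr G A K)
    (hne : (K \ core G A M).Nonempty) :
    ∃ M', IsPetal G A M' ∧ core G A M' ⊆ K \ M := by
  obtain ⟨hKA, -, hKcl⟩ := hK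
  have hNM : outerNbr G A K ⊆ M := fun y hy => by
    by_cases huy : u = y
    · exact huy ▸ hu.1
    · exact mem_of_adj_core hM.1 hu hy.1 (hKcl huK hy huy)
  have hne' : (K \ M).Nonempty := by
    obtain ⟨b, hbK, hb⟩ := hne
    by_cases hbM : b ∈ M
    · obtain ⟨-, M', hM', hMM', hbM'⟩ : b ∈ border G A M := by
        by_contra h
        exact hb ⟨hbM, h⟩
      have hsub := subset_of_isPrimeSubgraph hKcl hM'.prop.2 hM'.prop.1 hbM' hbK
      obtain ⟨z, hz, hzM⟩ := Set.not_subset.1 fun h => hMM' (hM'.eq_of_subset hM.1 h)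
      exact ⟨z, (hsub hz).resolve_right fun h => hzM (hNM h), hzM⟩
    · exact ⟨b, hbK, hbM⟩
  have hout : outerNbr G A (K \ M) ⊆ border G A M := by
    rintro y ⟨hyA, hy, z, hz, hzy⟩
    have hyM : y ∈ M := by
      by_cases hyK : y ∈ K
      · by_contra h
        exact hy ⟨hyK, h⟩
      · exact hNM ⟨hyA, hyK, z, hz.1, hzy⟩
    by_contra hyb
    exact hz.2 (mem_of_adj_core hM.1 ⟨hyM, hyb⟩ (hKA hz.1) hzy.symm)
  have hend : IsEnd G A (K \ M) := ⟨Set.sdiff_subset.trans hKA, hne', hM.2.2.subset hout⟩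
  obtain ⟨L, hLK, ⟨l, hl⟩, hpet, -⟩ := hend.exists_isPetal
  refine ⟨_, hpet, fun y hy => ?_⟩
  have hyM : y ∉ M := fun h => notMem_core_of_ne hM.1
    (fun he => (hLK hl).2 (he ▸ Or.inl hl)) h hy
  rcases hy.1 with h | h
  · exact hLK h
  · by_contra hyKM
    obtain ⟨hyA, -, k, hk, hky⟩ := h
    exact hyM (hout ⟨hyA, hyKM, k, hLK hk, hky⟩).1

/-! ### Complements of convex sets -/

/-- A vertex outside a convex set lies in a component of the complement, which is an end because two
nonadjacent vertices attached to it would be joined by an induced path through it. -/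
theorem exists_isEnd_of_notMem (hC : IsMConvex G C) (hxA : x ∈ A) (hxC : x ∉ C) :
    ∃ K, IsEnd G A K ∧ x ∈ K ∧ Disjoint K C ∧ outerNbr G A K ⊆ C := by
  let K : Set V := {y | ∃ p : G.Walk x y, ∀ z ∈ p.support, z ∈ A \ C}
  have hKAC : K ⊆ A \ C := fun y ⟨p, hp⟩ => hp y p.end_mem_support
  have hxK : x ∈ K := ⟨SimpleGraph.Walk.nil, fun z hz => by
    rw [SimpleGraph.Walk.support_nil, List.mem_singleton] at hz
    exact hz ▸ ⟨hxA, hxC⟩⟩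
  have hNC : outerNbr G A K ⊆ C := by
    rintro y ⟨hyA, hyK, k, ⟨p, hp⟩, hky⟩
    by_contra hyC
    refine hyK ⟨p.concat hky, fun z hz => ?_⟩
    rw [SimpleGraph.Walk.support_concat, List.mem_append,
      List.mem_singleton] at hz
    rcases hz with hz | rfl
    · exact hp z hz
    · exact ⟨hyA, hyC⟩
  refine ⟨K, ⟨fun y hy => (hKAC hy).1, ⟨x, hxK⟩, ?_⟩, hxK,
    Set.disjoint_left.2 fun y hy => (hKAC hy).2, hNC⟩
  intro y hy y' hy' hne
  obtain ⟨-, -, k, ⟨p, hp⟩, hky⟩ := id hy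
  obtain ⟨-, -, k', ⟨p', hp'⟩, hky'⟩ := id hy'
  refine (hC.eq_or_adj (hNC hy) (hNC hy')
    (SimpleGraph.Walk.cons hky.symm ((p.reverse.append p').concat hky')) ?_).resolve_left hne
  intro z hz
  rw [SimpleGraph.Walk.support_cons, List.mem_cons, SimpleGraph.Walk.support_concat,
    List.mem_append, List.mem_singleton,
    SimpleGraph.Walk.mem_support_append_iff, SimpleGraph.Walk.support_reverse,
    List.mem_reverse] at hz
  rcases hz with h | (h | h) | h
  · exact Or.inl h
  · exact Or.inr (Or.inr (hp z h).2)
  · exact Or.inr (Or.inr (hp' z h).2)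
  · exact Or.inr (Or.inl h)

/-- In a prime subgraph, any two nonadjacent vertices have the whole subgraph in their hull. -/
theorem IsMConvex.subset_of_not_adj (hC : IsMConvex G C) (hX : IsPrimeSubgraph G X)
    (hu : u ∈ X) (hv : v ∈ X) (huC : u ∈ C) (hvC : v ∈ C) (hne : u ≠ v) (huv : ¬ G.Adj u v) :
    X ⊆ C := by
  intro w hw
  by_contra hwC
  obtain ⟨K, ⟨-, -, hKcl⟩, hwK, hdis, -⟩ := exists_isEnd_of_notMem hC hw hwC
  have hsub := subset_of_isPrimeSubgraph hKcl hX subset_rfl hw hwK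
  have hC' : ∀ z ∈ X, z ∈ C → z ∈ outerNbr G X K := fun z hz hzC =>
    (hsub hz).resolve_left fun h => Set.disjoint_left.1 hdis h hzC
  exact huv (hKcl (hC' u hu huC) (hC' v hv hvC) hne)

/-! ### Convex sets obtained from petals -/

theorem isMConvex_diff_core_union [Finite V] (hA : IsMConvex G A) (hM : IsMPSubgraph G A M)
    {W : Set V} (hW : W ⊆ core G A M) (hcl : G.IsClique (W ∪ border G A M)) :
    IsMConvex G (A \ core G A M ∪ W) := by
  intro a b ha hb p hp x hx
  have hTA : A \ core G A M ∪ W ⊆ A :=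
    Set.union_subset Set.sdiff_subset (hW.trans (core_subset hM))
  have hpA : ∀ n, p.getVert n ∈ A := fun n =>
    hA (hTA ha) (hTA hb) p hp _ (p.getVert_mem_support n)
  -- The set is entered and left through vertices of `W ∪ border G A M`.
  have hstep : ∀ y z, y ∈ A \ core G A M ∪ W → z ∈ A → z ∉ A \ core G A M ∪ W → G.Adj z y →
      y ∈ W ∪ border G A M := by
    intro y z hy hz hzT hzy
    have hzc : z ∈ core G A M := by
      by_contra h
      exact hzT (Or.inl ⟨hz, h⟩)
    have hyM := mem_of_adj_core hM hzc (hTA hy) hzy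
    rcases hy with hy | hy
    · right
      by_contra h
      exact hy.2 ⟨hyM, h⟩
    · exact Or.inl hy
  by_contra hxT
  obtain ⟨j, rfl, hj⟩ := SimpleGraph.Walk.mem_support_iff_exists_getVert.1 hx
  have hexl : ∃ i, i ≤ j ∧ p.getVert (j - i) ∈ A \ core G A M ∪ W :=
    ⟨j, le_rfl, by rwa [Nat.sub_self, SimpleGraph.Walk.getVert_zero]⟩
  have hexr : ∃ i, j + i ≤ p.length ∧ p.getVert (j + i) ∈ A \ core G A M ∪ W :=
    ⟨p.length - j, by omega, by rwa [Nat.add_sub_cancel' hj, SimpleGraph.Walk.getVert_length]⟩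
  classical
  obtain ⟨hlj, hlT⟩ := Nat.find_spec hexl
  obtain ⟨hrj, hrT⟩ := Nat.find_spec hexr
  have hlmin := fun m => Nat.find_min hexl (m := m)
  have hrmin := fun m => Nat.find_min hexr (m := m)
  generalize Nat.find hexl = l at *
  generalize Nat.find hexr = r at *
  have hl0 : l ≠ 0 := by
    rintro rfl
    exact hxT hlT
  have hr0 : r ≠ 0 := by
    rintro rfl
    exact hxT hrT
  have hl : p.getVert (j - l) ∈ W ∪ border G A M := by
    refine hstep _ (p.getVert (j - l + 1)) hlT (hpA _) (fun h => ?_)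
      (p.adj_getVert_succ (by omega)).symm
    refine hlmin (l - 1) (by omega) ⟨by omega, ?_⟩
    rwa [show j - (l - 1) = j - l + 1 by omega]
  have hr : p.getVert (j + r) ∈ W ∪ border G A M := by
    obtain ⟨r, rfl⟩ := Nat.exists_eq_succ_of_ne_zero hr0
    exact hstep _ (p.getVert (j + r)) hrT (hpA _)
      (fun h => hrmin r (by omega) ⟨by omega, h⟩) (p.adj_getVert_succ (by omega))
  exact hp.false_of_isClique hcl (i := j - l) (j := j) (k := j + r) (by omega) (by omega) hrj hl hr

theorem IsFlower.isMConvex [Finite V] (hA : IsFlower G A) : IsMConvex G A := by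
  induction hA with
  | self => exact fun _ _ _ _ _ _ _ _ => Set.mem_univ _
  | remove _ hM ih =>
    have := isMConvex_diff_core_union ih hM.1 (W := ∅) (Set.empty_subset _)
      (by rw [Set.empty_union]; exact hM.2.2)
    rwa [Set.union_empty] at this

theorem IsStamenSet.isClique_diff_union (hX : IsStamenSet G A M X) (hM : IsPetal G A M)
    (hv : v ∈ X) : G.IsClique (X \ {v} ∪ border G A M) := by
  rcases hX.2 with h | ⟨u₁, u₂, rfl, h₁, h₂⟩ | ⟨h, -⟩
  · obtain ⟨a, rfl⟩ := Set.ncard_eq_one.1 h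
    obtain rfl : v = a := hv
    rw [Set.sdiff_self, Set.empty_union]
    exact hM.2.2
  · have hone : ∀ u, border G A M ⊆ G.neighborSet u → G.IsClique (insert u (border G A M)) :=
      fun u hu => hM.2.2.insert fun b hb _ => hu hb
    rcases hv with rfl | rfl
    · refine (hone u₂ h₂).subset ?_
      rintro z (⟨rfl | rfl, hz⟩ | hz)
      · exact absurd rfl hz
      · exact Or.inl rfl
      · exact Or.inr hz
    · refine (hone u₁ h₁).subset ?_
      rintro z (⟨rfl | rfl, hz⟩ | hz)
      · exact Or.inl rfl
      · exact absurd rfl hz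
      · exact Or.inr hz
  · exact h.subset (Set.union_subset_union_left _ Set.sdiff_subset)

/-- Choosing a stamen set in each petal of a flower subgraph gives an independent set. -/
theorem isMConvexlyIndep_iUnion_stamen [Finite V] (hA : IsFlower G A) (X : Set V → Set V)
    (hX : ∀ M, IsPetal G A M → IsStamenSet G A M (X M)) :
    IsMConvexlyIndep G {x | ∃ M, IsPetal G A M ∧ x ∈ X M} := by
  rintro v ⟨M, hM, hv⟩ hmem
  have hconv := isMConvex_diff_core_union hA.isMConvex hM.1 (W := X M \ {v})
    (Set.sdiff_subset.trans (hX M hM).1) ((hX M hM).isClique_diff_union hM hv)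
  have hvT := hmem _ ⟨?_, hconv⟩
  · rcases hvT with h | h
    · exact h.2 ((hX M hM).1 hv)
    · exact h.2 rfl
  · rintro s ⟨⟨M', hM', hs⟩, hsv⟩
    have hs' := (hX M' hM').1 hs
    by_cases hMM' : M' = M
    · subst hMM'
      exact Or.inr ⟨hs, hsv⟩
    · exact Or.inl ⟨core_subset hM'.1 hs', notMem_core_of_ne hM'.1 hMM' hs'.1⟩

/-! ### Independent sets and petals -/

/-- An independent set that meets the core of each petal lies in the union of the petal cores. For
`x ∈ S` outside the hull of `S \ {x}`, the component `K` of `x` contains no other vertex of `S`, so a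
petal with core in `K` has `x` in its core. If the core of the petal grown from a minimal end in `K`
sticks out of `K`, then it does so on the attaching clique, and another petal is found in `K`. -/
theorem exists_isPetal_mem_core [Finite V] (hS : IsMConvexlyIndep G S) (hSA : S ⊆ A)
    (hpet : ∀ M, IsPetal G A M → (S ∩ core G A M).Nonempty) (hx : x ∈ S) :
    ∃ M, IsPetal G A M ∧ x ∈ core G A M := by
  obtain ⟨K, hK, hxK, hdis, -⟩ :=
    exists_isEnd_of_notMem (isMConvex_mHull G _) (hSA hx) (hS x hx)
  have hSK : ∀ s ∈ S, s ∈ K → s = x := fun s hs hsK => by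
    by_contra hne
    exact Set.disjoint_left.1 hdis hsK (subset_mHull G _ ⟨hs, hne⟩)
  obtain ⟨L, hLK, -, hM, -⟩ := hK.exists_isPetal
  obtain ⟨s, hs, hsM⟩ := hpet _ hM
  by_cases hxM : x ∈ core G A (L ∪ outerNbr G A L)
  · exact ⟨_, hM, hxM⟩
  have hsK : s ∉ K := fun h => hxM (hSK s hs h ▸ hsM)
  have hsN : s ∈ outerNbr G A K := by
    obtain ⟨hsA, -, k, hk, hks⟩ := hsM.1.resolve_left fun h => hsK (hLK h)
    exact ⟨hsA, hsK, k, hLK hk, hks⟩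
  obtain ⟨M', hM', hsub⟩ := exists_isPetal_core_subset_diff hM hK hsM hsN ⟨x, hxK, hxM⟩
  obtain ⟨t, ht, htM⟩ := hpet _ hM'
  exact ⟨M', hM', hSK t ht (hsub htM).1 ▸ htM⟩

/-- Two vertices `u ≠ v` of an independent set in the core of a petal are joined to all of its
border. If `u` were not adjacent to a border vertex `b`, then either `b` is in the hull `C` of
`S \ {v}` and the whole petal, `v` included, lies in `C`, or the component of `b` outside `C` contains
the core of another petal, which misses `S`. -/
theorem border_subset_neighborSet [Finite V] (hS : IsMConvexlyIndep G S)
    (hpet : ∀ M, IsPetal G A M → (S ∩ core G A M).Nonempty) (hM : IsPetal G A M)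
    (hu : u ∈ S ∩ core G A M) (hv : v ∈ S ∩ core G A M) (huv : u ≠ v) :
    border G A M ⊆ G.neighborSet u := by
  intro b hb
  by_contra hub
  have huC := subset_mHull G (S \ {v}) ⟨hu.1, huv⟩
  have hconv := isMConvex_mHull G (S \ {v})
  have hbC : b ∉ mHull G (S \ {v}) := fun h =>
    hS v hv.1 (hconv.subset_of_not_adj hM.1.prop.2 hu.2.1 hb.1 huC h
      (fun he => hu.2.2 (he ▸ hb)) hub hv.2.1)
  obtain ⟨K, hK, hbK, hdis, -⟩ := exists_isEnd_of_notMem hconv (hM.1.prop.1 hb.1) hbC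
  have huN : u ∈ outerNbr G A K :=
    (subset_of_isPrimeSubgraph hK.2.2 hM.1.prop.2 hM.1.prop.1 hb.1 hbK hu.2.1).resolve_left
      fun h => Set.disjoint_left.1 hdis h huC
  obtain ⟨M', hM', hsub⟩ :=
    exists_isPetal_core_subset_diff hM hK hu.2 huN ⟨b, hbK, fun h => h.2 hb⟩
  obtain ⟨t, ht, htM⟩ := hpet _ hM'
  have htv : t ≠ v := fun h => (hsub htM).2 (h ▸ hv.2.1)
  exact Set.disjoint_left.1 hdis (hsub htM).1 (subset_mHull G _ ⟨ht, htv⟩)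

theorem isStamenSet_inter_core [Finite V] (hS : IsMConvexlyIndep G S)
    (hpet : ∀ M, IsPetal G A M → (S ∩ core G A M).Nonempty) (hM : IsPetal G A M) :
    IsStamenSet G A M (S ∩ core G A M) := by
  refine ⟨Set.inter_subset_right, ?_⟩
  have hpos := (Set.ncard_pos (Set.toFinite _)).2 (hpet M hM)
  by_cases hone : (S ∩ core G A M).ncard = 1
  · exact Or.inl hone
  have htwo : 2 ≤ (S ∩ core G A M).ncard := by omega
  have hadj : ∀ u ∈ S ∩ core G A M, border G A M ⊆ G.neighborSet u := fun u hu => by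
    obtain ⟨v, hv, hne⟩ := Set.exists_ne_of_one_lt_ncard htwo u
    exact border_subset_neighborSet hS hpet hM hu hv hne.symm
  right
  by_cases hcl : G.IsClique (S ∩ core G A M)
  · refine Or.inr ⟨?_, htwo⟩
    rintro a (ha | ha) b (hb | hb) hab
    · exact hcl ha hb hab
    · exact hadj a ha hb
    · exact (hadj b hb ha).symm
    · exact hM.2.2 ha hb hab
  · left
    obtain ⟨u, hu, v, hv, huv, hnadj⟩ : ∃ u ∈ S ∩ core G A M, ∃ v ∈ S ∩ core G A M,
        u ≠ v ∧ ¬ G.Adj u v := by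
      by_contra! h
      exact hcl fun a ha b hb hab => h a ha b hb hab
    refine ⟨u, v, Set.Subset.antisymm ?_ (Set.pair_subset hu hv), hadj u hu, hadj v hv⟩
    intro w hw
    by_contra hwuv
    have hwu : u ≠ w := fun h => hwuv (Or.inl h.symm)
    have hwv : v ≠ w := fun h => hwuv (Or.inr h.symm)
    exact hS w hw.1 ((isMConvex_mHull G (S \ {w})).subset_of_not_adj hM.1.prop.2 hu.2.1 hv.2.1
      (subset_mHull G _ ⟨hu.1, hwu⟩) (subset_mHull G _ ⟨hv.1, hwv⟩) huv hnadj hw.2.1)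

/-! ### The rank formula -/

theorem mem_petals [Finite V] : M ∈ petals G A ↔ IsPetal G A M :=
  Set.Finite.mem_toFinset _

/-- A minimal flower subgraph containing `S` is one from which no petal can be removed without
losing a vertex of `S`. -/
theorem exists_isFlower_forall_inter_core_nonempty [Finite V] (G : SimpleGraph V) (S : Set V) :
    ∃ A, IsFlower G A ∧ S ⊆ A ∧ ∀ M, IsPetal G A M → (S ∩ core G A M).Nonempty := by
  obtain ⟨A, -, hA⟩ := (Set.toFinite {A | IsFlower G A ∧ S ⊆ A}).exists_le_minimal
    (a := Set.univ) ⟨IsFlower.self, Set.subset_univ S⟩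
  refine ⟨A, hA.prop.1, hA.prop.2, fun M hM => ?_⟩
  by_contra hemp
  have hSc : S ⊆ A \ core G A M := fun s hs => ⟨hA.prop.2 hs, fun h => hemp ⟨s, hs, h⟩⟩
  obtain ⟨c, hc⟩ := hM.2.1
  exact (hA.le_of_le ⟨hA.prop.1.remove hM, hSc⟩ Set.sdiff_subset (core_subset hM.1 hc)).2 hc

theorem IsMConvexlyIndep.exists_isFlower_ncard_le [Finite V] (hS : IsMConvexlyIndep G S) :
    ∃ A, IsFlower G A ∧ S.ncard ≤ ∑ M ∈ petals G A, stamenNumber G A M := by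
  classical
  obtain ⟨A, hA, hSA, hpet⟩ := exists_isFlower_forall_inter_core_nonempty G S
  refine ⟨A, hA, ?_⟩
  have := Fintype.ofFinite V
  calc S.ncard = S.toFinset.card := Set.ncard_eq_toFinset_card' S
    _ ≤ ((petals G A).biUnion fun M => (S ∩ core G A M).toFinset).card := by
      refine Finset.card_le_card fun x hx => ?_
      obtain ⟨M, hM, hxM⟩ := exists_isPetal_mem_core hS hSA hpet (Set.mem_toFinset.1 hx)
      exact Finset.mem_biUnion.2
        ⟨M, mem_petals.2 hM, Set.mem_toFinset.2 ⟨Set.mem_toFinset.1 hx, hxM⟩⟩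
    _ ≤ ∑ M ∈ petals G A, (S ∩ core G A M).toFinset.card := Finset.card_biUnion_le
    _ ≤ ∑ M ∈ petals G A, stamenNumber G A M := by
      refine Finset.sum_le_sum fun M hM => ?_
      rw [← Set.ncard_eq_toFinset_card']
      exact (stamenNumber_isGreatest G (mem_petals.1 hM)).2
        ⟨_, isStamenSet_inter_core hS hpet (mem_petals.1 hM), rfl⟩

theorem IsFlower.exists_isMConvexlyIndep [Finite V] (hA : IsFlower G A) :
    ∃ S, IsMConvexlyIndep G S ∧ S.ncard = ∑ M ∈ petals G A, stamenNumber G A M := by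
  classical
  have := Fintype.ofFinite V
  have hex : ∀ M, ∃ X, IsPetal G A M → IsStamenSet G A M X ∧ X.ncard = stamenNumber G A M := by
    intro M
    by_cases hM : IsPetal G A M
    · obtain ⟨X, hX⟩ := (stamenNumber_isGreatest G hM).1
      exact ⟨X, fun _ => hX⟩
    · exact ⟨∅, fun h => absurd h hM⟩
  choose X hX using hex
  refine ⟨_, isMConvexlyIndep_iUnion_stamen hA X fun M hM => (hX M hM).1, ?_⟩
  have heq : {x | ∃ M, IsPetal G A M ∧ x ∈ X M} =
      ((petals G A).biUnion fun M => (X M).toFinset : Finset V) := by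
    ext x
    simp [mem_petals]
  rw [heq, Set.ncard_coe_finset, Finset.card_biUnion]
  · refine Finset.sum_congr rfl fun M hM => ?_
    rw [← Set.ncard_eq_toFinset_card', (hX M (mem_petals.1 hM)).2]
  · intro M hM M' hM' hne
    rw [Function.onFun, Set.disjoint_toFinset, Set.disjoint_left]
    intro x hx hx'
    exact notMem_core_of_ne (mem_petals.1 hM).1 hne
      ((hX M (mem_petals.1 hM)).1.1 hx).1 ((hX M' (mem_petals.1 hM')).1.1 hx')

end Monophonic

theorem corollary3 {V : Type*} [Finite V] (G : SimpleGraph V) :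
    IsGreatest
      {n : ℕ | ∃ A : Set V, Monophonic.IsFlower G A ∧
        n = ∑ M ∈ Monophonic.petals G A, Monophonic.stamenNumber G A M}
      (Monophonic.mRank G) := by
  obtain ⟨⟨S, hS, hcard⟩, hmax⟩ := Monophonic.mRank_isGreatest G
  have hub : ∀ A, Monophonic.IsFlower G A →
      ∑ M ∈ Monophonic.petals G A, Monophonic.stamenNumber G A M ≤ Monophonic.mRank G :=
    fun A hA => hmax hA.exists_isMConvexlyIndep
  refine ⟨?_, ?_⟩
  · obtain ⟨A, hA, hle⟩ := hS.exists_isFlower_ncard_le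
    exact ⟨A, hA, le_antisymm (hcard ▸ hle) (hub A hA)⟩
  · rintro n ⟨A, hA, rfl⟩
    exact hub A hA
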